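/- Throughout, "$T^*|_W$ is an isomorphism" means that $T^*|_W$ is an isomorphism onto its image, i.e. there is $\delta>0$ with $\|T^*w\|\ge\delta\|w\|$ for all $w\in W$, and $\widetilde{\mathrm{Span}}$ denotes the weak$^*$ closure of the linear span. Schreier families. For every countable limit ordinal $\xi$ fix a strictly increasing sequence $(\xi_n)_{n\ge1}$ of ordinals with supremum $\xi$. Define families of finite sets of positive integers by $S_0=\{\emptyset\}\cup\{\{n\}:n\ge 1\}$; $S_{\xi+1}$ is the family of all $F=F_1\cup\dots\cup F_n$ with $F_1,\dots,F_n\in S_\xi$, $F_1<F_2<\dots<F_n$ and $n\le \min F$ (together with $\emptyset$); and, for $\xi$ a limit, $S_\xi=\{\emptyset\}\cup\{F:\ F\in S_{\xi_n}\text{ for some } n\le\min F\}$. Let $X,Y$ be (real or complex) Banach spaces and let $(\mathcal A_i)_{i\in I}$ be a family of sets of basic sequences $(y_n^*)_{n\ge1}$ in $Y^*$. A bounded linear operator $T:X\to Y$ is called $(\mathcal A_i)_{i\in I}$ strictly cosingular, $T\in(\mathcal A_i)_{i\in I}\text{-}\mathcal{SC}(X,Y)$, if for every $i\in I$ there are $(y_n^*)_n\in\mathcal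 A_i$ and an infinite set $N$ of positive integers such that for every finite $F\subset N$ the restriction $T^*|_{\widetilde{\mathrm{Span}}\,(y_n^*)_{n\notin F}}$ is not an isomorphism. For $1\le\xi<\omega_1$, $T$ is called $(\mathcal A_i)_{i\in I}$-$S_\xi$ strictly cosingular, $T\in(\mathcal A_i)_{i\in I}\text{-}\mathcal{SC}_\xi(X,Y)$, if the same holds with "every finite $F\subset N$" replaced by "every finite $F\subset N$ with $F\in S_\xi$". Theorem. Let $X$ and $Y$ be Banach spaces with $Y$ separable, and let $(\mathcal A_i)_{i\in I}$ be a family of analytic sets of basic sequences in $Y^*$, where analytic means: empty or a continuous image of a Polish space, as a subset of the countable product of copies of $(Y^*,\text{weak}^*)$. Then $$(\mathcal A_i)_{i\in I}\text{-}\mathcal{SC}(X,Y)=\bigcap_{1\le\xi<\omega_1}(\mathcal A_i)_{i\in I}\text{-}\mathcal{SC}_\xi(X,Y).$$ -/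

import Mathlib

open scoped Ordinal

/-- `c` assigns to every countable limit ordinal `ξ` a strictly increasing sequence of ordinals
with supremum `ξ`. Such a choice is what the limit step of the Schreier hierarchy depends on. -/
def IsLadderSystem (c : Ordinal.{0} → ℕ+ → Ordinal.{0}) : Prop :=
  ∀ ξ : Ordinal.{0}, Order.IsSuccLimit ξ → ξ < ω₁ →
    StrictMono (c ξ) ∧ IsLUB (Set.range (c ξ)) ξ

/-- From a family `S`, the finite sets `F = F₁ ∪ ⋯ ∪ Fₙ` with `n ≤ F₁ < F₂ < ⋯ < Fₙ` and
every `Fᵢ` in `S`. -/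
def schreierSucc (S : Set (Finset ℕ+)) : Set (Finset ℕ+) :=
  {F | ∃ (n : ℕ) (G : Fin n → Finset ℕ+),
    (∀ i, G i ∈ S) ∧
    (∀ i j, i < j → ∀ a ∈ G i, ∀ b ∈ G j, a < b) ∧
    (∀ k ∈ F, n ≤ (k : ℕ)) ∧
    F = Finset.univ.biUnion G}

/-- The Schreier family `S_ξ` of finite sets of positive integers, built along `c`:
`S_0` consists of the empty set and the singletons; `S_{ξ+1} = schreierSucc S_ξ`; and for a limit
ordinal `ξ` a set `F` is in `S_ξ` if there is `n ≤ min F` with `F ∈ S_{c ξ n}`. -/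
noncomputable def schreier (c : Ordinal.{0} → ℕ+ → Ordinal.{0}) (ξ : Ordinal.{0}) :
    Set (Finset ℕ+) :=
  Ordinal.limitRecOn (motive := fun _ => Set (Finset ℕ+)) ξ
    {F | F.card ≤ 1}
    (fun _ S => schreierSucc S)
    (fun ξ _ S => {F | ∃ (n : ℕ+) (h : c ξ n < ξ), F ∈ S (c ξ n) h ∧ ∀ k ∈ F, n ≤ k})

theorem schreier_zero (c : Ordinal.{0} → ℕ+ → Ordinal.{0}) :
    schreier c 0 = {F | F.card ≤ 1} := by
  simp [schreier]

theorem schreier_add_one (c : Ordinal.{0} → ℕ+ → Ordinal.{0}) (ξ : Ordinal.{0}) :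
    schreier c (ξ + 1) = schreierSucc (schreier c ξ) := by
  simp only [schreier, Ordinal.limitRecOn_add_one]

theorem schreier_limit (c : Ordinal.{0} → ℕ+ → Ordinal.{0}) (ξ : Ordinal.{0})
    (hξ : Order.IsSuccLimit ξ) :
    schreier c ξ =
      {F | ∃ n : ℕ+, c ξ n < ξ ∧ F ∈ schreier c (c ξ n) ∧ ∀ k ∈ F, n ≤ k} := by
  unfold schreier
  rw [Ordinal.limitRecOn_limit (h := hξ)]
  ext F
  simp only [Set.mem_ofPred_eq, exists_prop]

section Operators

variable (𝕜 : Type*) [RCLike 𝕜]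

/-- `(x_n)_{n ≥ 1}` is a basic sequence: a Schauder basis of the norm closure of its span. -/
def IsBasicSequence {E : Type*} [NormedAddCommGroup E] [NormedSpace 𝕜 E] (x : ℕ+ → E) : Prop :=
  ∃ b : GeneralSchauderBasis ℕ+ 𝕜 (Submodule.span 𝕜 (Set.range x)).topologicalClosure
      (SummationFilter.conditional ℕ+),
    ∀ n, (b.basis n : E) = x n

/-- A set of sequences in the dual of `Y` is analytic as a subset of the countable product
of copies of the dual with its weak* topology. -/
def IsWeakStarAnalytic {Y : Type*} [NormedAddCommGroup Y] [NormedSpace 𝕜 Y]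
    (A : Set (ℕ+ → StrongDual 𝕜 Y)) : Prop :=
  MeasureTheory.AnalyticSet
    ((fun (y : ℕ+ → StrongDual 𝕜 Y) (n : ℕ+) => StrongDual.toWeakDual (y n)) '' A)

/-- The weak* closure of the linear span of `(y_n)_{n ∉ F}`. -/
noncomputable def weakStarSpanOff {Y : Type*} [NormedAddCommGroup Y] [NormedSpace 𝕜 Y]
    (y : ℕ+ → StrongDual 𝕜 Y) (F : Finset ℕ+) : Submodule 𝕜 (StrongDual 𝕜 Y) :=
  (Submodule.span 𝕜
    {w : WeakDual 𝕜 Y | ∃ n ∉ F, w = StrongDual.toWeakDual (y n)}).topologicalClosure.comap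
      (StrongDual.toWeakDual (𝕜 := 𝕜) (E := Y)).toLinearMap

variable {𝕜}
variable {X Y : Type*} [NormedAddCommGroup X] [NormedSpace 𝕜 X]
  [NormedAddCommGroup Y] [NormedSpace 𝕜 Y]

/-- The restriction of the adjoint `T* : w ↦ w ∘ T` to the subspace `W` is an isomorphism onto
its image, i.e. it is bounded below. -/
def AdjointIsoOn (T : X →L[𝕜] Y) (W : Submodule 𝕜 (StrongDual 𝕜 Y)) : Prop :=
  ∃ δ : ℝ, 0 < δ ∧ ∀ w ∈ W, δ * ‖w‖ ≤ ‖w.comp T‖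

variable (X)

/-- The class of `(A_i)`-strictly cosingular operators from `X` to `Y`. -/
def strictlyCosingular {ι : Type*} (A : ι → Set (ℕ+ → StrongDual 𝕜 Y)) : Set (X →L[𝕜] Y) :=
  {T | ∀ i, ∃ y ∈ A i, ∃ N : Set ℕ+, N.Infinite ∧
    ∀ F : Finset ℕ+, (F : Set ℕ+) ⊆ N → ¬ AdjointIsoOn T (weakStarSpanOff 𝕜 y F)}

/-- The class of `(A_i)`-`S`-strictly cosingular operators from `X` to `Y`, for a family `S` of
finite sets of positive integers. -/
def strictlyCosingularAlong {ι : Type*} (A : ι → Set (ℕ+ → StrongDual 𝕜 Y))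
    (S : Set (Finset ℕ+)) : Set (X →L[𝕜] Y) :=
  {T | ∀ i, ∃ y ∈ A i, ∃ N : Set ℕ+, N.Infinite ∧
    ∀ F : Finset ℕ+, (F : Set ℕ+) ⊆ N → F ∈ S →
      ¬ AdjointIsoOn T (weakStarSpanOff 𝕜 y F)}

end Operators

/-!
Only the inclusion from right to left needs an argument, and the index `ξ = 1` alone yields it: a
set `F` with `#F ≤ min F` belongs to `S_1`, and a sequence `y` that is bad for all such subsets of
some infinite `N` is already bad for all finite subsets of another infinite set `N'`
(`exists_infinite_forall_not_adjointIsoOn`). The same `y` serves for both classes.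

Write `W_F` for the weak* closed span of `(y_n)_{n ∉ F}`. Since adding a finite-dimensional space to
a closed one gives a closed one, `W_F ≤ W_{F ∪ G} + span (y_n)_{n ∈ G}`
(`weakStarSpanOff_le_sup`). If `T*` is not an isomorphism on any `W_F`, take `N' = N`. Otherwise
`T*` is an isomorphism on some `W_G`, which has finite codimension in `W_∅`. Then
`K = ker T* ∩ W_∅` is finite-dimensional, and `T*` is an isomorphism on `W_F` exactly when
`K ∩ W_F = 0` (`ContinuousLinearMap.exists_pos_forall_mul_norm_le_of_eq_sup`).

What remains is linear algebra (`exists_infinite_forall_inf_ne_bot`). Let `P` be a maximal set of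
indices all of whose finite subsets `F` satisfy `W_F = W_∅`. If `P` is infinite, take `N' = P`. If
`P` is finite, maximality makes the remaining indices independent, in the sense that
`W_{P ∪ F} = W_P ∩ ⋂_{n ∈ F} W_{P ∪ {n}}` for `F` disjoint from `P`
(`mem_union_of_forall_mem_insert`). As `W_F ≤ W_{P ∪ F} + span (y_n)_{n ∈ P}`, a nonzero vector of
`K ∩ W_F` corresponds to a pair `(p, k)` in the finite-dimensional space `span (y_n)_{n ∈ P} × K`
with `k ≠ 0` and `k - p ∈ W_P` that lies in the subspaces given by `k - p ∈ W_{P ∪ {n}}` for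
`n ∈ F`. An intersection of subspaces
of a `d`-dimensional space is reached by at most `d` of them, and any `d` indices that are at least
`d` form a set with `#F ≤ min F`, so one pair works for all finite `F` at once.
-/

/-! ### Linear algebra -/

/-- Inside a finite-dimensional subspace `E`, the intersection of a family of subspaces is attained
by at most `finrank E` of its members. -/
theorem exists_finset_card_le_finrank_forall_mem {𝕜 V ι : Type*} [DivisionRing 𝕜] [AddCommGroup V]
    [Module 𝕜 V] (L : ι → Submodule 𝕜 V) (S : Set ι) (E : Submodule 𝕜 V)
    [hE : FiniteDimensional 𝕜 E] :
    ∃ F : Finset ι, (F : Set ι) ⊆ S ∧ F.card ≤ Module.finrank 𝕜 E ∧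
      ∀ x ∈ E, (∀ n ∈ F, x ∈ L n) → ∀ n ∈ S, x ∈ L n := by
  classical
  induction hd : Module.finrank 𝕜 E using Nat.strong_induction_on generalizing E with
  | _ d ih =>
    by_cases h : ∀ n ∈ S, E ≤ L n
    · exact ⟨∅, by simp, by simp, fun x hx _ n hn => h n hn hx⟩
    · push Not at h
      obtain ⟨n, hn, hnE⟩ := h
      have hlt : E ⊓ L n < E := inf_lt_left.2 hnE
      have hfin : FiniteDimensional 𝕜 (E ⊓ L n : Submodule 𝕜 V) :=
        Submodule.finiteDimensional_of_le inf_le_left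
      have hr := Submodule.finrank_lt_finrank_of_lt hlt
      obtain ⟨F, hFS, hFc, hF⟩ := ih _ (hd ▸ hr) (E ⊓ L n) rfl
      refine ⟨insert n F, ?_, ?_, ?_⟩
      · rw [Finset.coe_insert]
        exact Set.insert_subset hn hFS
      · exact (Finset.card_insert_le _ _).trans (by omega)
      · intro x hx hxF
        exact hF x ⟨hx, hxF n (Finset.mem_insert_self _ _)⟩
          fun m hm => hxF m (Finset.mem_insert_of_mem hm)

section Filtration

variable {𝕜 D : Type*} [Field 𝕜] [AddCommGroup D] [Module 𝕜 D]

/-- If no `y n` with `n ∉ P` lies in `W (insert n P)`, then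
`W (P ∪ F) = W P ⊓ ⨅ n ∈ F, W (insert n P)` for `F` disjoint from `P`; this is the nontrivial
inclusion. -/
theorem mem_union_of_forall_mem_insert {y : ℕ+ → D} {W : Finset ℕ+ → Submodule 𝕜 D}
    (hanti : Antitone W)
    (hsup : ∀ F G : Finset ℕ+, W F ≤ W (F ∪ G) ⊔ Submodule.span 𝕜 (y '' G))
    {P : Finset ℕ+} (hP : ∀ n ∉ P, y n ∉ W (insert n P)) (F : Finset ℕ+) (hF : Disjoint F P)
    {w : D} (hw : w ∈ W P) (hwF : ∀ n ∈ F, w ∈ W (insert n P)) : w ∈ W (P ∪ F) := by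
  induction F using Finset.induction_on with
  | empty => simpa using hw
  | insert n F hn ih =>
    rw [Finset.disjoint_insert_left] at hF
    have h1 := hsup _ {n} (ih hF.2 fun m hm => hwF m (Finset.mem_insert_of_mem hm))
    obtain ⟨v, hv, u, hu, rfl⟩ := Submodule.mem_sup.1 h1
    have hv' : v ∈ W (P ∪ insert n F) := by
      convert hv using 2
      ext; simp
    obtain ⟨c, rfl⟩ : ∃ c : 𝕜, c • y n = u := by
      simpa [Submodule.mem_span_singleton] using hu
    have hvn : v ∈ W (insert n P) := hanti (fun m hm => by
      simp only [Finset.mem_insert, Finset.mem_union] at hm ⊢; tauto) hv'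
    have hc : c • y n ∈ W (insert n P) := by
      simpa using sub_mem (hwF n (Finset.mem_insert_self _ _)) hvn
    have hc0 : c = 0 := by
      by_contra hc0
      exact hP n hF.1 ((Submodule.smul_mem_iff _ hc0).1 hc)
    simpa [hc0] using hv'

/-- For a finite-dimensional `K`, it suffices to test `K ⊓ W F ≠ ⊥` on the sets `F ⊆ N` that have at
most `min F` elements in order to get an infinite set on all of whose finite subsets it holds. -/
theorem exists_infinite_forall_inf_ne_bot {y : ℕ+ → D} {W : Finset ℕ+ → Submodule 𝕜 D}
    (hanti : Antitone W) (hy : ∀ F, ∀ n ∉ F, y n ∈ W F)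
    (hsup : ∀ F G : Finset ℕ+, W F ≤ W (F ∪ G) ⊔ Submodule.span 𝕜 (y '' G))
    (K : Submodule 𝕜 D) [FiniteDimensional 𝕜 K] {N : Set ℕ+} (hN : N.Infinite)
    (hK : ∀ F : Finset ℕ+, (F : Set ℕ+) ⊆ N → (∀ k ∈ F, F.card ≤ (k : ℕ)) → K ⊓ W F ≠ ⊥) :
    ∃ N' : Set ℕ+, N'.Infinite ∧ ∀ F : Finset ℕ+, (F : Set ℕ+) ⊆ N' → K ⊓ W F ≠ ⊥ := by
  classical
  -- The sets of indices whose finite subsets can be omitted without shrinking the span.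
  let I : Set (Set ℕ+) := {M | ∀ F : Finset ℕ+, (F : Set ℕ+) ⊆ M → W F = W ∅}
  have hI : Order.IsOfFiniteCharacter I := by
    refine fun M => ⟨fun hM M' hM' _ F hF => hM F (hF.trans hM'), fun h F hF => ?_⟩
    exact h F hF F.finite_toSet F subset_rfl
  have hI0 : (∅ : Set ℕ+) ∈ I := fun F hF => by
    rw [Set.subset_empty_iff, Finset.coe_eq_empty] at hF
    rw [hF]
  obtain ⟨M, -, hM⟩ := hI.exists_maximal hI0
  by_cases hMinf : M.Infinite
  · refine ⟨M, hMinf, fun F hF => ?_⟩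
    rw [hM.prop F hF]
    exact hK ∅ (by simp) (by simp)
  rw [Set.not_infinite] at hMinf
  lift M to Finset ℕ+ using hMinf with P
  have hWP : W P = W ∅ := hM.prop P subset_rfl
  have hP : ∀ n ∉ P, y n ∉ W (insert n P) := by
    intro n hn hyn
    have hins : insert n (P : Set ℕ+) ∈ I := by
      intro F hF
      refine le_antisymm (hanti (Finset.empty_subset _)) ?_
      have h1 := hsup P {n}
      rw [Finset.union_comm, ← Finset.insert_eq, Finset.coe_singleton, Set.image_singleton,
        sup_eq_left.2 ((Submodule.span_singleton_le_iff_mem _ _).2 hyn), hWP] at h1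
      refine h1.trans (hanti ?_)
      rwa [← Finset.coe_insert, Finset.coe_subset] at hF
    exact hn (hM.le_of_ge hins (Set.subset_insert _ _) (Set.mem_insert _ _))
  -- A vector `k = p + v` of `K ⊓ W F`, with `p ∈ span (y '' P)` and `v ∈ W (P ∪ F)`, is encoded as
  -- the pair `(p, k)`, and `f (p, k) = v`.
  let f : D × D →ₗ[𝕜] D := LinearMap.snd 𝕜 D D - LinearMap.fst 𝕜 D D
  let U : Submodule 𝕜 D := Submodule.span 𝕜 (y '' P)
  have hU : FiniteDimensional 𝕜 U :=
    FiniteDimensional.span_of_finite 𝕜 (P.finite_toSet.image _)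
  have hUK : FiniteDimensional 𝕜 (U.prod K) := .of_fg (Submodule.FG.prod
    (Module.Finite.iff_fg.1 hU) (Module.Finite.iff_fg.1 inferInstance))
  let E : Submodule 𝕜 (D × D) := U.prod K ⊓ (W P).comap f
  have hE : FiniteDimensional 𝕜 E := Submodule.finiteDimensional_of_le inf_le_left
  let d := Module.finrank 𝕜 E
  -- Subsets of `N'` with at most `d` elements are among those to which `hK` applies.
  let N' : Set ℕ+ := N \ (P ∪ {k | (k : ℕ) < d})
  have hd : {k : ℕ+ | (k : ℕ) < d}.Finite :=
    (Set.finite_lt_nat d).preimage PNat.coe_injective.injOn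
  have hN' : N'.Infinite := hN.sdiff (P.finite_toSet.union hd)
  have hdisj : ∀ n ∈ N', n ∉ P := fun n hn hnP => hn.2 (Or.inl hnP)
  obtain ⟨F₀, hF₀N, hF₀c, hF₀⟩ :=
    exists_finset_card_le_finrank_forall_mem (fun n => (W (insert n P)).comap f) N' E
  obtain ⟨k, ⟨hkK, hkW⟩, hk0⟩ := (Submodule.ne_bot_iff _).1 <| hK F₀
    (hF₀N.trans Set.sdiff_subset) fun n hn => hF₀c.trans <| by
      have := (hF₀N hn).2
      simp only [Set.mem_union, not_or, Set.mem_ofPred_eq, not_lt] at this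
      exact this.2
  obtain ⟨v, hv, p, hp, rfl⟩ := Submodule.mem_sup.1 (hsup F₀ P hkW)
  have hfv : f (p, v + p) = v := by simp [f]
  have hmem : ((p, v + p) : D × D) ∈ E := by
    refine ⟨⟨hp, hkK⟩, ?_⟩
    rw [SetLike.mem_coe, Submodule.mem_comap, hfv]
    exact hanti Finset.subset_union_right hv
  have hall := hF₀ _ hmem fun n hn => by
    rw [Submodule.mem_comap, hfv]
    refine hanti (Finset.insert_subset (Finset.mem_union_left _ hn) Finset.subset_union_right) hv
  simp only [Submodule.mem_comap, hfv] at hall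
  refine ⟨N', hN', fun F hF => (Submodule.ne_bot_iff _).2 ⟨v + p, ⟨hkK, ?_⟩, hk0⟩⟩
  have hFP : Disjoint F P := Finset.disjoint_left.2 fun n hn => hdisj n (hF hn)
  refine add_mem ?_ ?_
  · exact hanti Finset.subset_union_right <| mem_union_of_forall_mem_insert hanti hsup hP F hFP
      (hanti Finset.subset_union_right hv) fun n hn => hall n (hF hn)
  · refine Submodule.span_le.2 ?_ hp
    rintro _ ⟨n, hn, rfl⟩
    exact hy F n (Finset.disjoint_right.1 hFP hn)

end Filtration

/-! ### Lower bounds on finite-dimensional extensions -/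

/-- An operator bounded below on a closed subspace `V` remains bounded below on a closed
finite-dimensional extension `W` of `V` as soon as it is injective there: its range on `W` is the
closed range on `V` plus a finite-dimensional space, so the open mapping theorem applies. -/
theorem ContinuousLinearMap.exists_pos_forall_mul_norm_le_of_eq_sup {𝕜 E F : Type*} [RCLike 𝕜]
    [NormedAddCommGroup E] [NormedSpace 𝕜 E] [CompleteSpace E]
    [NormedAddCommGroup F] [NormedSpace 𝕜 F] [CompleteSpace F]
    (A : E →L[𝕜] F) {V U W : Submodule 𝕜 E} [FiniteDimensional 𝕜 U]
    (hV : IsClosed (V : Set E)) (hW : IsClosed (W : Set E)) (hWVU : W = V ⊔ U)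
    {δ : ℝ} (hδ : 0 < δ) (hA : ∀ v ∈ V, δ * ‖v‖ ≤ ‖A v‖) (hinj : ∀ w ∈ W, A w = 0 → w = 0) :
    ∃ ε : ℝ, 0 < ε ∧ ∀ w ∈ W, ε * ‖w‖ ≤ ‖A w‖ := by
  have hrange : ∀ S : Submodule 𝕜 E, (S.map A.toLinearMap : Set F) =
      Set.range (A.comp S.subtypeL) := by
    intro S
    ext x
    simp
  have hAV : IsClosed (V.map A.toLinearMap : Set F) := by
    have : CompleteSpace V := hV.completeSpace_coe
    have hanti : AntilipschitzWith (Real.toNNReal δ⁻¹) (A.comp V.subtypeL) := by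
      refine ContinuousLinearMap.antilipschitz_of_bound (A.comp V.subtypeL) fun v => ?_
      rw [Real.coe_toNNReal _ (by positivity), ← div_eq_inv_mul, le_div_iff₀ hδ, mul_comm]
      exact hA v v.2
    rw [hrange]
    exact hanti.isClosed_range (A.comp V.subtypeL).uniformContinuous
  have hAW : IsClosed (W.map A.toLinearMap : Set F) := by
    rw [hWVU, Submodule.map_sup]
    exact Submodule.isClosed_sup_finiteDimensional _ _ hAV
  have : CompleteSpace W := hW.completeSpace_coe
  rw [hrange] at hAW
  obtain ⟨K, hK⟩ := (A.comp W.subtypeL).antilipschitz_of_injective_of_isClosed_range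
    ((injective_iff_map_eq_zero (A.comp W.subtypeL)).2
      fun w hw => Subtype.ext (hinj w w.2 hw)) hAW
  -- `K` may be `0`, hence the summand `1`.
  refine ⟨((K : ℝ) + 1)⁻¹, by positivity, fun w hw => ?_⟩
  rw [← div_eq_inv_mul, div_le_iff₀ (by positivity)]
  have h1 : ‖w‖ ≤ K * ‖A w‖ := by
    simpa using hK.le_mul_dist (⟨w, hw⟩ : W) 0
  nlinarith [norm_nonneg (A w)]

/-! ### Weak* closed spans -/

section WeakStarSpan

variable {𝕜 : Type*} [RCLike 𝕜] {X Y : Type*} [NormedAddCommGroup X] [NormedSpace 𝕜 X]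
  [NormedAddCommGroup Y] [NormedSpace 𝕜 Y]

theorem weakStarSpanOff_antitone (y : ℕ+ → StrongDual 𝕜 Y) :
    Antitone (weakStarSpanOff 𝕜 y) := by
  intro F G hFG
  refine Submodule.comap_mono (Submodule.topologicalClosure_mono (Submodule.span_mono ?_))
  rintro w ⟨n, hn, rfl⟩
  exact ⟨n, fun h => hn (hFG h), rfl⟩

theorem mem_weakStarSpanOff (y : ℕ+ → StrongDual 𝕜 Y) (F : Finset ℕ+) (n : ℕ+) (hn : n ∉ F) :
    y n ∈ weakStarSpanOff 𝕜 y F :=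
  Submodule.le_topologicalClosure
    (Submodule.span 𝕜 {w : WeakDual 𝕜 Y | ∃ n ∉ F, w = StrongDual.toWeakDual (y n)})
    (Submodule.subset_span ⟨n, hn, rfl⟩)

theorem isClosed_weakStarSpanOff (y : ℕ+ → StrongDual 𝕜 Y) (F : Finset ℕ+) :
    IsClosed (weakStarSpanOff 𝕜 y F : Set (StrongDual 𝕜 Y)) :=
  (Submodule.isClosed_topologicalClosure
    (Submodule.span 𝕜 {w : WeakDual 𝕜 Y | ∃ n ∉ F, w = StrongDual.toWeakDual (y n)})).preimage
      NormedSpace.Dual.toWeakDual_continuous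

/-- Omitting the indices of `G` as well costs at most the finite-dimensional space `span (y '' G)`,
since the sum of a weak* closed subspace and a finite-dimensional one is weak* closed. -/
theorem weakStarSpanOff_le_sup (y : ℕ+ → StrongDual 𝕜 Y) (F G : Finset ℕ+) :
    weakStarSpanOff 𝕜 y F ≤ weakStarSpanOff 𝕜 y (F ∪ G) ⊔ Submodule.span 𝕜 (y '' G) := by
  let e := StrongDual.toWeakDual (𝕜 := 𝕜) (E := Y)
  let V : Submodule 𝕜 (WeakDual 𝕜 Y) :=
    (Submodule.span 𝕜 {w | ∃ n ∉ F ∪ G, w = e (y n)}).topologicalClosure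
  let U : Submodule 𝕜 (WeakDual 𝕜 Y) := Submodule.span 𝕜 (e '' (y '' G))
  have hU : FiniteDimensional 𝕜 U :=
    FiniteDimensional.span_of_finite 𝕜 ((G.finite_toSet.image _).image _)
  have hcl : IsClosed ((V ⊔ U : Submodule 𝕜 (WeakDual 𝕜 Y)) : Set (WeakDual 𝕜 Y)) :=
    Submodule.isClosed_sup_finiteDimensional _ _ (Submodule.isClosed_topologicalClosure _)
  have hle : (Submodule.span 𝕜 {w | ∃ n ∉ F, w = e (y n)}).topologicalClosure ≤ V ⊔ U := by
    refine Submodule.topologicalClosure_minimal _ (Submodule.span_le.2 ?_) hcl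
    rintro _ ⟨n, hn, rfl⟩
    by_cases hG : n ∈ G
    · exact Submodule.mem_sup_right (Submodule.subset_span ⟨_, ⟨n, hG, rfl⟩, rfl⟩)
    · refine Submodule.mem_sup_left (Submodule.le_topologicalClosure _ (Submodule.subset_span ?_))
      exact ⟨n, by simp [hn, hG], rfl⟩
  intro w hw
  obtain ⟨v, hv, u, hu, huv⟩ := Submodule.mem_sup.1 (hle hw)
  refine Submodule.mem_sup.2 ⟨e.symm v, ?_, e.symm u, ?_, ?_⟩
  · exact hv
  · have : U = (Submodule.span 𝕜 (y '' G)).map e.toLinearMap := by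
      rw [Submodule.map_span]; rfl
    rw [this] at hu
    obtain ⟨u', hu', rfl⟩ := hu
    exact hu'
  · rw [← map_add, huv]
    exact e.symm_apply_apply w

/-! ### The adjoint on weak* closed spans -/

theorem AdjointIsoOn.eq_zero {T : X →L[𝕜] Y} {W : Submodule 𝕜 (StrongDual 𝕜 Y)}
    (h : AdjointIsoOn T W) {w : StrongDual 𝕜 Y} (hw : w ∈ W) (h0 : w.comp T = 0) : w = 0 := by
  obtain ⟨δ, hδ, h⟩ := h
  have := h w hw
  rw [h0, norm_zero] at this
  exact norm_le_zero_iff.1 (nonpos_of_mul_nonpos_right this hδ)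

/-- Every set with at most `min F` elements is in the Schreier family of index `1`. -/
theorem mem_schreierSucc_card_le_one {F : Finset ℕ+} (hF : ∀ k ∈ F, F.card ≤ (k : ℕ)) :
    F ∈ schreierSucc {G : Finset ℕ+ | G.card ≤ 1} := by
  refine ⟨F.card, fun i => {F.orderEmbOfFin rfl i}, by simp, ?_, hF, ?_⟩
  · intro i j hij a ha b hb
    rw [Finset.mem_singleton] at ha hb
    rw [ha, hb]
    exact (F.orderEmbOfFin rfl).strictMono hij
  · ext k
    rw [Finset.mem_biUnion, ← Finset.mem_coe, ← F.range_orderEmbOfFin rfl]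
    simp only [Set.mem_range, Finset.mem_univ, Finset.mem_singleton, true_and, eq_comm]

/-- Failure of the isomorphism property on the Schreier subsets of index `1` of an infinite set
propagates, for the same sequence, to all finite subsets of some infinite set. -/
theorem exists_infinite_forall_not_adjointIsoOn (T : X →L[𝕜] Y) (y : ℕ+ → StrongDual 𝕜 Y)
    {N : Set ℕ+} (hN : N.Infinite)
    (hT : ∀ F : Finset ℕ+, (F : Set ℕ+) ⊆ N → (∀ k ∈ F, F.card ≤ (k : ℕ)) →
      ¬ AdjointIsoOn T (weakStarSpanOff 𝕜 y F)) :
    ∃ N' : Set ℕ+, N'.Infinite ∧ ∀ F : Finset ℕ+, (F : Set ℕ+) ⊆ N' →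
      ¬ AdjointIsoOn T (weakStarSpanOff 𝕜 y F) := by
  by_cases hG : ∃ G, AdjointIsoOn T (weakStarSpanOff 𝕜 y G)
  swap
  · exact ⟨N, hN, fun F _ h => hG ⟨F, h⟩⟩
  obtain ⟨G, hG⟩ := hG
  let W := weakStarSpanOff 𝕜 y
  let A : StrongDual 𝕜 Y →L[𝕜] StrongDual 𝕜 X := (ContinuousLinearMap.compL 𝕜 X Y 𝕜).flip T
  let K : Submodule 𝕜 (StrongDual 𝕜 Y) := LinearMap.ker A.toLinearMap ⊓ W ∅
  -- `K` embeds into the image of `span (y '' G)` in the quotient by `W G`, because `T*` is injective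
  -- on `W G`.
  have hK : FiniteDimensional 𝕜 K := by
    let U := (Submodule.span 𝕜 (y '' G)).map (W G).mkQ
    have hU : FiniteDimensional 𝕜 (Submodule.span 𝕜 (y '' G)) :=
      FiniteDimensional.span_of_finite 𝕜 (G.finite_toSet.image _)
    have hmem : ∀ k ∈ K, (W G).mkQ k ∈ U := by
      intro k hk
      obtain ⟨v, hv, u, hu, rfl⟩ := Submodule.mem_sup.1 (weakStarSpanOff_le_sup y ∅ G hk.2)
      rw [Finset.empty_union] at hv
      refine ⟨u, hu, ?_⟩
      rw [map_add, Submodule.mkQ_apply (W G) v, (Submodule.Quotient.mk_eq_zero (W G)).2 hv, zero_add]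
    refine FiniteDimensional.of_injective ((W G).mkQ.restrict hmem) ?_
    refine (injective_iff_map_eq_zero _).2 fun k hk => ?_
    have h0 : (W G).mkQ k = 0 := congrArg Subtype.val hk
    exact Subtype.ext (hG.eq_zero ((Submodule.Quotient.mk_eq_zero (W G)).1 h0) k.2.1)
  have hiff : ∀ F, AdjointIsoOn T (W F) ↔ K ⊓ W F = ⊥ := by
    refine fun F => ⟨fun h => ?_, fun h => ?_⟩
    · exact (Submodule.eq_bot_iff _).2 fun k hk => h.eq_zero hk.2 hk.1.1
    · have hU : FiniteDimensional 𝕜 (Submodule.span 𝕜 (y '' G) ⊓ W F : Submodule 𝕜 _) := by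
        have := FiniteDimensional.span_of_finite 𝕜 (G.finite_toSet.image y)
        exact Submodule.finiteDimensional_of_le inf_le_left
      have hVW : W (F ∪ G) ≤ W F := weakStarSpanOff_antitone y Finset.subset_union_left
      have hWF : W F = W (F ∪ G) ⊔ Submodule.span 𝕜 (y '' G) ⊓ W F := by
        rw [← sup_inf_assoc_of_le _ hVW]
        exact (inf_eq_right.2 (weakStarSpanOff_le_sup y F G)).symm
      obtain ⟨δ, hδ, hle⟩ := hG
      exact A.exists_pos_forall_mul_norm_le_of_eq_sup (isClosed_weakStarSpanOff y (F ∪ G))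
        (isClosed_weakStarSpanOff y F) hWF hδ
        (fun v hv => hle v (weakStarSpanOff_antitone y Finset.subset_union_right hv))
        fun w hw h0 => (Submodule.eq_bot_iff _).1 h w
          ⟨⟨h0, weakStarSpanOff_antitone y (Finset.empty_subset F) hw⟩, hw⟩
  obtain ⟨N', hN', h⟩ := exists_infinite_forall_inf_ne_bot (W := W) (weakStarSpanOff_antitone y)
    (mem_weakStarSpanOff y) (weakStarSpanOff_le_sup y) K hN
    fun F hFN hF h0 => hT F hFN hF ((hiff F).2 h0)
  exact ⟨N', hN', fun F hF hiso => h F hF ((hiff F).1 hiso)⟩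

end WeakStarSpan

theorem mainTheorem3 {𝕜 : Type*} [RCLike 𝕜]
    {X : Type*} [NormedAddCommGroup X] [NormedSpace 𝕜 X] [CompleteSpace X]
    {Y : Type*} [NormedAddCommGroup Y] [NormedSpace 𝕜 Y] [CompleteSpace Y]
    [TopologicalSpace.SeparableSpace Y]
    {ι : Type*} (A : ι → Set (ℕ+ → StrongDual 𝕜 Y))
    (hbasic : ∀ i, ∀ y ∈ A i, IsBasicSequence 𝕜 y)
    (hanalytic : ∀ i, IsWeakStarAnalytic 𝕜 (A i))
    (c : Ordinal.{0} → ℕ+ → Ordinal.{0}) (hc : IsLadderSystem c) :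
    strictlyCosingular X A =
      ⋂ ξ ∈ {ξ : Ordinal.{0} | 1 ≤ ξ ∧ ξ < ω₁},
        strictlyCosingularAlong X A (schreier c ξ) := by
  refine Set.Subset.antisymm (fun T hT => Set.mem_iInter₂.2 fun ξ _ i => ?_) fun T hT i => ?_
  · obtain ⟨y, hy, N, hN, h⟩ := hT i
    exact ⟨y, hy, N, hN, fun F hF _ => h F hF⟩
  · have h1 : (1 : Ordinal.{0}) < ω₁ := Ordinal.one_lt_omega0.trans Ordinal.omega0_lt_omega_one
    -- The index `1` alone suffices.
    obtain ⟨y, hy, N, hN, h⟩ := Set.mem_iInter₂.1 hT 1 ⟨le_rfl, h1⟩ i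
    refine ⟨y, hy, exists_infinite_forall_not_adjointIsoOn T y hN fun F hFN hF => h F hFN ?_⟩
    rw [← zero_add (1 : Ordinal.{0}), schreier_add_one, schreier_zero]
    exact mem_schreierSucc_card_le_one hF
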